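/- Let $B,U,L,W$ be integers with $B\ge 1$ and $1\le L\le W$, let $\sigma\ge 0$, and let $\delta\in\mathbb{R}$ be such that the $B\times B$ matrix $R$ with ones on the diagonal and $\delta$ off the diagonal is positive semidefinite (for $B\ge 2$ this means $-1/(B-1)\le\delta\le 1$); let $R^{1/2}$ be its positive semidefinite square root. Let $H_\ell$ ($\ell=0,\dots,L-1$) and $E_\omega$ ($\omega=0,\dots,W-1$) be random complex $B\times U$ matrices all of whose entries are jointly independent, the entries of $H_\ell$ being circularly-symmetric complex Gaussian $\mathcal{CN}(0,1/(BL))$ and those of $E_\omega$ being $\mathcal{CN}(0,1)$. For each subcarrier $\omega\in\{0,\dots,W-1\}$ put $$\widehat H_\omega=\sum_{\ell=0}^{L-1}R^{1/2}H_\ell\,e^{-j2\pi\omega\ell/W}+\sigma E_\omega,\qquad G_\omega=\widehat H_\omega^{H}\widehat H_\omega .$$ Let $p_0<\dots<p_{K-1}$ be base points in a set $\Omega\subseteq\{0,\dots,W-1\}$ of active subcarriers, let $\omega\in\Omega$ not be a base point, and let $p_k\le\omega\le p_{k+1}$. Put $\lambda=(p_{k+1}-\omega)/(p_{k+1}-p_k)$,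 $\theta=\frac{2\pi}{W}(p_{k+1}-p_k)$ and $\widetilde G_\omega=\lambda G_{p_k}+(1-\lambda)G_{p_{k+1}}$ (1st-order interpolation). Then for every entry $(m,n)$ the random variable $\big|[\widetilde G_\omega]_{m,n}-[G_\omega]_{m,n}\big|^2$ is integrable, and its expectation does not depend on $(m,n)$ and equals $$\mathbb{E}\big|[\widetilde G_\omega]_{m,n}-[G_\omega]_{m,n}\big|^2=\varepsilon_{\rm CSI}\big(1-\lambda(1-\lambda)\big)+\frac{2}{B}(1+\varepsilon_{\rm cor})\Big(1-\lambda(1-\lambda)+\lambda(1-\lambda)f_L(\theta)-(1-\lambda)f_L(\lambda\theta)-\lambda f_L((1-\lambda)\theta)\Big),$$ where $\varepsilon_{\rm CSI}=2\sigma^2(2+B\sigma^2)$, $\varepsilon_{\rm cor}=\delta^2(B-1)$ and $f_L(\phi)=L^{-2}\frac{1-\cos(L\phi)}{1-\cos\phi}$ is the scaled Fejér kernel (extended by $1$ where $\cos\phi=1$). -/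

import Mathlib

open MeasureTheory ProbabilityTheory
open scoped NNReal Matrix ComplexOrder MatrixOrder

noncomputable section

namespace GramInterp

/-- The circularly-symmetric complex Gaussian law `CN(0, v)`: independent real and imaginary parts,
each a centred real Gaussian of variance `v / 2`. -/
def complexNormal (v : ℝ≥0) : Measure ℂ :=
  ((gaussianReal 0 (v / 2)).prod (gaussianReal 0 (v / 2))).map
    (fun z : ℝ × ℝ => (z.1 : ℂ) + (z.2 : ℂ) * Complex.I)

/-- The correlation matrix `(1 - δ) I + δ 1`: ones on the diagonal, `δ` off the diagonal. -/
def corrMatrix (B : ℕ) (δ : ℝ) : Matrix (Fin B) (Fin B) ℂ :=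
  Matrix.of fun i j => if i = j then 1 else (δ : ℂ)

/-- The correlated time-domain tap `R^{1/2} H`, where `R^{1/2}` is the positive semidefinite square
root of the correlation matrix `R`. -/
def timeChannel {B U : ℕ} (δ : ℝ) (Hu : Matrix (Fin B) (Fin U) ℂ) : Matrix (Fin B) (Fin U) ℂ :=
  CFC.sqrt (corrMatrix B δ) * Hu

/-- The frequency-domain channel matrix on subcarrier `w` with channel-estimation error:
`∑_{ℓ < L} R^{1/2} H_ℓ exp(-j 2 π w ℓ / W) + σ E_w`. -/
def freqChannel {B U L W : ℕ} (δ σ : ℝ) (Hu : Fin L → Matrix (Fin B) (Fin U) ℂ)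
    (E : Fin W → Matrix (Fin B) (Fin U) ℂ) (w : Fin W) : Matrix (Fin B) (Fin U) ℂ :=
  (∑ l : Fin L,
    Complex.exp (-(Complex.I * (2 * Real.pi * ((w : ℕ) : ℂ) * ((l : ℕ) : ℂ)) / (W : ℂ))) •
      timeChannel δ (Hu l)) + (σ : ℂ) • E w

/-- The Gram matrix `Hᴴ H` on subcarrier `w`. -/
def gram {B U L W : ℕ} (δ σ : ℝ) (Hu : Fin L → Matrix (Fin B) (Fin U) ℂ)
    (E : Fin W → Matrix (Fin B) (Fin U) ℂ) (w : Fin W) : Matrix (Fin U) (Fin U) ℂ :=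
  (freqChannel δ σ Hu E w)ᴴ * freqChannel δ σ Hu E w

/-- The interpolation weight `λ = (q - w) / (q - p)` for the target `w` between `p` and `q`. -/
def weight {W : ℕ} (p q w : Fin W) : ℝ :=
  (((q : ℕ) : ℝ) - ((w : ℕ) : ℝ)) / (((q : ℕ) : ℝ) - ((p : ℕ) : ℝ))

/-- First-order (linear) interpolation, at `w`, of a family of matrices known at `p` and `q`. -/
def linInterp {U W : ℕ} (G : Fin W → Matrix (Fin U) (Fin U) ℂ) (p q w : Fin W) :
    Matrix (Fin U) (Fin U) ℂ :=
  (weight p q w : ℂ) • G p + ((1 - weight p q w : ℝ) : ℂ) • G q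

/-- The squared error of the `(m, n)` entry of the linearly interpolated Gram matrix at `w`. -/
def sqError {B U L W : ℕ} (δ σ : ℝ) (Hu : Fin L → Matrix (Fin B) (Fin U) ℂ)
    (E : Fin W → Matrix (Fin B) (Fin U) ℂ) (p q w : Fin W) (m n : Fin U) : ℝ :=
  ‖linInterp (gram δ σ Hu E) p q w m n - gram δ σ Hu E w m n‖ ^ 2

/-- The scaled Fejér kernel `L⁻² (1 - cos (L φ)) / (1 - cos φ)`, with the value `1` of its continuous
extension where `cos φ = 1`. -/
def fejer (L : ℕ) (φ : ℝ) : ℝ :=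
  if Real.cos φ = 1 then 1
  else ((L : ℝ) ^ 2)⁻¹ * ((1 - Real.cos (L * φ)) / (1 - Real.cos φ))

/-- `ε_CSI = 2 σ² (2 + B σ²)`. -/
def epsCSI (B : ℕ) (σ : ℝ) : ℝ := 2 * σ ^ 2 * (2 + B * σ ^ 2)

/-- `ε_cor = δ² (B - 1)`. -/
def epsCor (B : ℕ) (δ : ℝ) : ℝ := δ ^ 2 * ((B : ℝ) - 1)

end GramInterp

end

/-! The interpolation error is `∑ a_r [G_{x_r}]_{mn}` over the subcarriers `p_k, p_{k+1}, ω` with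
weights `λ, 1 - λ, -1`, which sum to zero. Each Gram entry is a sum over antennas of `X̄ Y`, with
`X`, `Y` linear forms in the independent Gaussians. For such sums Wick's formula
(`integral_norm_sq_sum_conj_mul`) gives `𝔼|∑ d_r X̄_r Y_r|² = |∑ d_r 𝔼 X̄_r Y_r|² + ∑ d_r d̄_t
𝔼(X̄_r X_t) conj 𝔼(Ȳ_r Y_t)`. The mean of a Gram entry is the same on every subcarrier, so the first
term vanishes, also when `m = n`. The second involves only covariances within one column, which are
the same for every column; hence the independence of `(m, n)`. Summed over antenna pairs
(`sum_sq_cov`), they give the Fejér kernel at the phase difference, plus `ε_CSI / 2` when the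
subcarriers coincide. The diagonal weights contribute `λ² + (1 - λ)² + 1 = 2 (1 - λ (1 - λ))`. -/

namespace GramInterp

/-! ### Moments of real and complex Gaussian laws -/

section Moments

lemma integral_sq_gaussianReal (v : ℝ≥0) : ∫ x, x ^ 2 ∂(gaussianReal 0 v) = v := by
  have h := variance_fun_id_gaussianReal (μ := 0) (v := v)
  rw [variance_of_integral_eq_zero aemeasurable_id' (by simp)] at h
  simpa using h

lemma integral_pow_four_gaussianReal (v : ℝ≥0) :
    ∫ x, x ^ 4 ∂(gaussianReal 0 v) = 3 * (v : ℝ) ^ 2 := by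
  have h := iteratedDeriv_mgf_zero (X := id) (μ := gaussianReal 0 v)
    (by rw [integrableExpSet_id_gaussianReal]; simp) 4
  have hm : mgf id (gaussianReal 0 v) = fun t ↦ Real.exp (v * t ^ 2 / 2) := by
    rw [mgf_id_gaussianReal]; simp
  -- Differentiating `p e^{vt²/2}` replaces `p` by `q = p' + v t p`. Four rounds starting from `p =
  -- 1` leave constant term `3 v²`.
  have step (p q : ℝ → ℝ) (hp : ∀ t, HasDerivAt p (q t - v * t * p t) t) :
      deriv (fun t ↦ p t * Real.exp (v * t ^ 2 / 2)) =
        fun t ↦ q t * Real.exp (v * t ^ 2 / 2) := by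
    funext t
    have he : HasDerivAt (fun t : ℝ ↦ Real.exp (v * t ^ 2 / 2))
        (Real.exp (v * t ^ 2 / 2) * (v * t)) t := by
      refine HasDerivAt.exp ?_
      convert! ((hasDerivAt_pow 2 t).const_mul (v : ℝ)).div_const 2 using 1
      simp; ring
    refine ((hp t).mul he).deriv.trans ?_
    ring
  have e : (fun t : ℝ ↦ Real.exp (v * t ^ 2 / 2)) =
      fun t ↦ (fun _ : ℝ ↦ (1 : ℝ)) t * Real.exp (v * t ^ 2 / 2) := by simp
  rw [hm, iteratedDeriv_succ, iteratedDeriv_succ, iteratedDeriv_succ, iteratedDeriv_one, e,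
    step _ (fun t ↦ v * t), step _ (fun t ↦ v + v ^ 2 * t ^ 2),
    step _ (fun t ↦ 3 * v ^ 2 * t + v ^ 3 * t ^ 3),
    step _ (fun t ↦ 3 * v ^ 2 + 6 * v ^ 3 * t ^ 2 + v ^ 4 * t ^ 4)] at h
  · simpa using h.symm
  · intro t
    convert! ((hasDerivAt_id t).const_mul (3 * (v : ℝ) ^ 2)).add
      ((hasDerivAt_pow 3 t).const_mul ((v : ℝ) ^ 3)) using 1
    simp; ring
  · intro t
    convert! ((hasDerivAt_pow 2 t).const_mul ((v : ℝ) ^ 2)).const_add (v : ℝ) using 1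
    simp; ring
  · intro t
    convert! (hasDerivAt_id t).const_mul (v : ℝ) using 1
    simp; ring
  · intro t
    convert! hasDerivAt_const t (1 : ℝ) using 1
    simp

lemma measurable_add_mul_I : Measurable (fun z : ℝ × ℝ => (z.1 : ℂ) + (z.2 : ℂ) * Complex.I) := by
  fun_prop

instance (v : ℝ≥0) : IsProbabilityMeasure (complexNormal v) :=
  Measure.isProbabilityMeasure_map measurable_add_mul_I.aemeasurable

/-- A quarter turn sends `(x, y)` to `(-y, x)`. This much of the circular symmetry suffices to kill
the unbalanced moments of low order. -/
lemma complexNormal_map_I_mul (v : ℝ≥0) :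
    (complexNormal v).map (fun z => Complex.I * z) = complexNormal v := by
  have h : MeasurePreserving (fun z : ℝ × ℝ => (-z.2, z.1))
      ((gaussianReal 0 (v / 2)).prod (gaussianReal 0 (v / 2)))
      ((gaussianReal 0 (v / 2)).prod (gaussianReal 0 (v / 2))) := by
    have h1 : MeasurePreserving (fun x : ℝ => -x) (gaussianReal 0 (v / 2))
        (gaussianReal 0 (v / 2)) := ⟨measurable_neg, by rw [gaussianReal_map_neg, neg_zero]⟩
    exact (h1.prod (MeasurePreserving.id _)).comp Measure.measurePreserving_swap
  rw [complexNormal, Measure.map_map (by fun_prop) measurable_add_mul_I]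
  conv_rhs => rw [← h.map_eq, Measure.map_map measurable_add_mul_I h.measurable]
  congr 1
  funext z
  simp only [Function.comp_apply, Complex.ofReal_neg]
  linear_combination (z.2 : ℂ) * Complex.I_sq

lemma memLp_id_complexNormal (v : ℝ≥0) (p : ENNReal) (hp : p ≠ ⊤) :
    MemLp (fun z : ℂ => z) p (complexNormal v) := by
  rw [complexNormal, memLp_map_measure_iff (by fun_prop) measurable_add_mul_I.aemeasurable]
  have h := memLp_id_gaussianReal' (μ := 0) (v := v / 2) p hp
  have h1 : MemLp (fun z : ℝ × ℝ => (z.1 : ℂ)) p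
      ((gaussianReal 0 (v / 2)).prod (gaussianReal 0 (v / 2))) :=
    (h.comp_measurePreserving measurePreserving_fst).ofReal
  have h2 : MemLp (fun z : ℝ × ℝ => (z.2 : ℂ)) p
      ((gaussianReal 0 (v / 2)).prod (gaussianReal 0 (v / 2))) :=
    (h.comp_measurePreserving measurePreserving_snd).ofReal
  exact h1.add (h2.mul_const Complex.I)

lemma integrable_pow_gaussianReal (v : ℝ≥0) (k : ℕ) :
    Integrable (fun x => x ^ k) (gaussianReal 0 v) :=
  integrable_pow_of_mem_interior_integrableExpSet (X := id)
    (by rw [integrableExpSet_id_gaussianReal]; simp) k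

lemma integral_normSq_complexNormal (v : ℝ≥0) :
    ∫ z, Complex.normSq z ∂(complexNormal v) = v := by
  rw [complexNormal, integral_map measurable_add_mul_I.aemeasurable (by fun_prop)]
  simp only [Complex.normSq_add_mul_I]
  have h := integrable_pow_gaussianReal (v / 2) 2
  rw [integral_add (h.comp_fst _) (h.comp_snd _), integral_fun_fst (f := fun x : ℝ => x ^ 2),
    integral_fun_snd (f := fun x : ℝ => x ^ 2), integral_sq_gaussianReal]
  simp

lemma integral_normSq_sq_complexNormal (v : ℝ≥0) :
    ∫ z, Complex.normSq z ^ 2 ∂(complexNormal v) = 2 * (v : ℝ) ^ 2 := by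
  rw [complexNormal, integral_map measurable_add_mul_I.aemeasurable (by fun_prop)]
  simp only [Complex.normSq_add_mul_I]
  have h2 := integrable_pow_gaussianReal (v / 2) 2
  have h4 := integrable_pow_gaussianReal (v / 2) 4
  have e (z : ℝ × ℝ) : (z.1 ^ 2 + z.2 ^ 2) ^ 2 =
      z.1 ^ 4 + z.2 ^ 4 + 2 * (z.1 ^ 2 * z.2 ^ 2) := by ring
  simp only [e]
  have h44 : Integrable (fun z : ℝ × ℝ => z.1 ^ 4 + z.2 ^ 4)
      ((gaussianReal 0 (v / 2)).prod (gaussianReal 0 (v / 2))) :=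
    (h4.comp_fst _).add (h4.comp_snd _)
  rw [integral_add h44 ((h2.mul_prod h2).const_mul 2),
    integral_add (h4.comp_fst _) (h4.comp_snd _), integral_const_mul,
    integral_fun_fst (f := fun x : ℝ => x ^ 4), integral_fun_snd (f := fun x : ℝ => x ^ 4),
    integral_prod_mul (fun x : ℝ => x ^ 2) (fun x : ℝ => x ^ 2),
    integral_sq_gaussianReal, integral_pow_four_gaussianReal]
  simp; ring

/-- The moments `𝔼 z^a z̄^b` of order at most two in each of `z` and `z̄`. -/
lemma integral_pow_mul_conj_pow_complexNormal (v : ℝ≥0) {a b : ℕ} (ha : a ≤ 2) (hb : b ≤ 2) :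
    ∫ z, z ^ a * (starRingEnd ℂ z) ^ b ∂(complexNormal v) =
      if a = b then (a.factorial : ℂ) * (v : ℂ) ^ a else 0 := by
  split_ifs with hab
  · subst hab
    have e (z : ℂ) : z ^ a * (starRingEnd ℂ z) ^ a = ((Complex.normSq z ^ a : ℝ) : ℂ) := by
      rw [← mul_pow, Complex.mul_conj]; simp
    simp only [e, integral_complex_ofReal]
    interval_cases a
    · simp
    · simp [integral_normSq_complexNormal]
    · simp [integral_normSq_sq_complexNormal]
  · set J := ∫ z, z ^ a * (starRingEnd ℂ z) ^ b ∂(complexNormal v) with hJ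
    have h : J = Complex.I ^ a * (-Complex.I) ^ b * J := by
      conv_lhs => rw [hJ, ← complexNormal_map_I_mul,
        integral_map (by fun_prop) (by fun_prop)]
      rw [hJ, ← integral_const_mul]
      congr 1
      funext z
      simp only [map_mul, Complex.conj_I, mul_pow]
      ring
    -- Here `0 < |a - b| ≤ 2`, so `i^(a - b)` cannot be `1`; the bounds on `a` and `b` are
    -- essential.
    have hne : Complex.I ^ a * (-Complex.I) ^ b ≠ 1 := by
      clear_value J
      clear h hJ
      interval_cases a <;> interval_cases b <;>
        first
        | exact absurd rfl hab
        | norm_num [pow_two, Complex.ext_iff]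
    by_contra h0
    exact hne (mul_right_cancel₀ h0 (by rw [one_mul]; exact h.symm))

end Moments

/-! ### Wick's formula and second moments of sesquilinear forms -/

section QuadForm

variable {S ι : Type*} [MeasurableSpace S] {μ : Measure S} [Fintype ι]
  {Z : ι → S → ℂ} {v : ι → ℝ≥0}

/-- The exponent counts occurrences of `t` in the pair `(x, y)`. The factor `2! = 2` at `x = y`
reflects two coinciding Wick pairings. -/
lemma prod_factorial_mul_pow [DecidableEq ι] (c : ι → ℂ) (x y : ι) :
    ∏ t, ((((if t = x then 1 else 0) + (if t = y then 1 else 0) : ℕ).factorial : ℂ) *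
      c t ^ ((if t = x then 1 else 0) + (if t = y then 1 else 0))) =
    (if x = y then 2 else 1) * (c x * c y) := by
  rw [Finset.prod_mul_distrib]
  congr 1
  · split_ifs with h
    · subst h
      rw [Finset.prod_eq_single x] <;> simp +contextual
    · refine Finset.prod_eq_one fun t _ => ?_
      by_cases hx : t = x
      · simp [hx, h]
      · by_cases hy : t = y <;> simp [hx, hy]
        simp [← hy, hx]
  · simp only [pow_add, Finset.prod_mul_distrib, pow_ite, pow_one, pow_zero, Finset.prod_ite_eq',
      Finset.mem_univ, if_true]

/-- Wick's formula for four independent circular Gaussian factors. -/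
lemma integral_four [DecidableEq ι] (hZ : ∀ i, HasLaw (Z i) (complexNormal (v i)) μ)
    (hind : iIndepFun Z μ) (i j k l : ι) :
    ∫ s, starRingEnd ℂ (Z i s) * Z j s * (Z k s * starRingEnd ℂ (Z l s)) ∂μ =
      (if i = j ∧ k = l then (v i : ℂ) * v k else 0) +
      (if i = k ∧ j = l then (v i : ℂ) * v j else 0) := by
  -- `a t` and `b t` are the exponents of `Z t` and its conjugate. The product of moments survives
  -- only if `{j, k} = {i, l}` as multisets.
  let a : ι → ℕ := fun t => (if t = j then 1 else 0) + (if t = k then 1 else 0)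
  let b : ι → ℕ := fun t => (if t = i then 1 else 0) + (if t = l then 1 else 0)
  have ha (t) : a t ≤ 2 := by dsimp only [a]; split_ifs <;> simp
  have hb (t) : b t ≤ 2 := by dsimp only [b]; split_ifs <;> simp
  have e (s : S) : starRingEnd ℂ (Z i s) * Z j s * (Z k s * starRingEnd ℂ (Z l s)) =
      ∏ t, (fun z : ℂ => z ^ a t * (starRingEnd ℂ z) ^ b t) (Z t s) := by
    simp only [a, b, pow_add, Finset.prod_mul_distrib, pow_ite, pow_one, pow_zero,
      Finset.prod_ite_eq', Finset.mem_univ, if_true]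
    ring
  have hint : ∫ s, starRingEnd ℂ (Z i s) * Z j s * (Z k s * starRingEnd ℂ (Z l s)) ∂μ =
      ∏ t, if a t = b t then ((a t).factorial : ℂ) * (v t : ℂ) ^ a t else 0 := by
    simp only [e]
    rw [hind.integral_fun_prod_comp (f := fun t z => z ^ a t * (starRingEnd ℂ z) ^ b t)
      (fun t => (hZ t).aemeasurable) (fun t => by fun_prop)]
    refine Finset.prod_congr rfl fun t _ => ?_
    rw [← integral_pow_mul_conj_pow_complexNormal _ (ha t) (hb t)]
    exact (hZ t).integral_comp (f := fun z => z ^ a t * (starRingEnd ℂ z) ^ b t) (by fun_prop)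
  have zero (t : ι) (ht : a t ≠ b t) :
      ∏ t, (if a t = b t then ((a t).factorial : ℂ) * (v t : ℂ) ^ a t else 0) = 0 :=
    Finset.prod_eq_zero (Finset.mem_univ t) (if_neg ht)
  have full (h : ∀ t, a t = b t) :
      ∏ t, (if a t = b t then ((a t).factorial : ℂ) * (v t : ℂ) ^ a t else 0) =
        (if j = k then 2 else 1) * (v j * v k) := by
    rw [← prod_factorial_mul_pow fun t => (v t : ℂ)]
    exact Finset.prod_congr rfl fun t _ => if_pos (h t)
  rw [hint]
  by_cases hij : i = j
  · subst hij
    by_cases hkl : k = l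
    · subst hkl
      rw [full fun t => rfl]
      by_cases hik : i = k
      · subst hik; simp; ring
      · simp [hik]
    · rw [zero k (by simp [a, b, hkl])]
      have : ¬ (i = k ∧ i = l) := fun h => hkl (h.1.symm.trans h.2)
      simp [hkl, this]
  · by_cases hik : i = k
    · subst hik
      by_cases hjl : j = l
      · subst hjl
        rw [full fun t => add_comm _ _]
        simp [hij, Ne.symm hij]; ring
      · rw [zero j (by simp [a, b, hjl, Ne.symm hij])]
        simp [hij, hjl]
    · rw [zero i (by simp [a, b, hij, hik]; omega)]
      simp [hij, hik]

omit [Fintype ι] in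
lemma memLp_conj_mul (hZ : ∀ i, HasLaw (Z i) (complexNormal (v i)) μ) (i j : ι) :
    MemLp (fun s => starRingEnd ℂ (Z i s) * Z j s) 2 μ := by
  have h (i) : MemLp (Z i) 4 μ := by
    have h := memLp_id_complexNormal (v i) 4 (by simp)
    rw [← (hZ i).map_eq] at h
    exact (memLp_map_measure_iff (by fun_prop) (hZ i).aemeasurable).1 h
  have : ENNReal.HolderTriple 4 4 2 := ⟨by
    rw [← ENNReal.toReal_eq_toReal_iff' (by simp) (by simp), ENNReal.toReal_add (by simp) (by simp)]
    norm_num⟩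
  exact (h j).mul (h i).star

lemma memLp_quadForm (hZ : ∀ i, HasLaw (Z i) (complexNormal (v i)) μ) (A : ι → ι → ℂ) :
    MemLp (fun s => ∑ i, ∑ j, A i j * (starRingEnd ℂ (Z i s) * Z j s)) 2 μ :=
  memLp_finsetSum _ fun i _ => memLp_finsetSum _ fun j _ =>
    (memLp_conj_mul hZ i j).const_mul (A i j)

/-- Second moment of a sesquilinear form in independent circular Gaussian variables. -/
theorem integral_norm_sq_quadForm (hZ : ∀ i, HasLaw (Z i) (complexNormal (v i)) μ)
    (hind : iIndepFun Z μ) (A : ι → ι → ℂ) :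
    ((∫ s, ‖∑ i, ∑ j, A i j * (starRingEnd ℂ (Z i s) * Z j s)‖ ^ 2 ∂μ : ℝ) : ℂ) =
      (∑ i, (v i : ℂ) * A i i) * starRingEnd ℂ (∑ i, (v i : ℂ) * A i i) +
        ∑ i, ∑ j, (v i : ℂ) * v j * (A i j * starRingEnd ℂ (A i j)) := by
  classical
  have e (s : S) : ((‖∑ i, ∑ j, A i j * (starRingEnd ℂ (Z i s) * Z j s)‖ ^ 2 : ℝ) : ℂ) =
      ∑ i, ∑ j, ∑ k, ∑ l, (A i j * starRingEnd ℂ (A k l)) *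
        (starRingEnd ℂ (Z i s) * Z j s * (Z k s * starRingEnd ℂ (Z l s))) := by
    rw [Complex.ofReal_pow, ← Complex.mul_conj']
    simp only [map_sum, map_mul, Complex.conj_conj]
    rw [Finset.sum_mul]
    refine Finset.sum_congr rfl fun i _ => ?_
    rw [Finset.sum_mul]
    refine Finset.sum_congr rfl fun j _ => ?_
    rw [Finset.mul_sum]
    refine Finset.sum_congr rfl fun k _ => ?_
    rw [Finset.mul_sum]
    refine Finset.sum_congr rfl fun l _ => ?_
    ring
  have hI (i j k l : ι) : Integrable (fun s => (A i j * starRingEnd ℂ (A k l)) *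
      (starRingEnd ℂ (Z i s) * Z j s * (Z k s * starRingEnd ℂ (Z l s)))) μ := by
    refine Integrable.const_mul ?_ _
    refine ((memLp_conj_mul hZ i j).integrable_mul (memLp_conj_mul hZ l k)).congr
      (Filter.Eventually.of_forall fun s => ?_)
    simp only [Pi.mul_apply]; ring
  rw [← integral_complex_ofReal]
  simp only [e]
  have hs : ∫ s, ∑ i, ∑ j, ∑ k, ∑ l, (A i j * starRingEnd ℂ (A k l)) *
        (starRingEnd ℂ (Z i s) * Z j s * (Z k s * starRingEnd ℂ (Z l s))) ∂μ =
      ∑ i, ∑ j, ∑ k, ∑ l, (A i j * starRingEnd ℂ (A k l)) *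
        ((if i = j ∧ k = l then (v i : ℂ) * v k else 0) +
          (if i = k ∧ j = l then (v i : ℂ) * v j else 0)) := by
    rw [integral_finsetSum _ fun i _ => integrable_finsetSum _ fun j _ =>
      integrable_finsetSum _ fun k _ => integrable_finsetSum _ fun l _ => hI i j k l]
    refine Finset.sum_congr rfl fun i _ => ?_
    rw [integral_finsetSum _ fun j _ =>
      integrable_finsetSum _ fun k _ => integrable_finsetSum _ fun l _ => hI i j k l]
    refine Finset.sum_congr rfl fun j _ => ?_
    rw [integral_finsetSum _ fun k _ => integrable_finsetSum _ fun l _ => hI i j k l]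
    refine Finset.sum_congr rfl fun k _ => ?_
    rw [integral_finsetSum _ fun l _ => hI i j k l]
    refine Finset.sum_congr rfl fun l _ => ?_
    rw [integral_const_mul, integral_four hZ hind]
  rw [hs]
  simp only [mul_add, Finset.sum_add_distrib]
  -- The pairing `i = j, k = l` yields the squared mean, the pairing `i = k, j = l` the weighted sum
  -- of `|A i j|²`.
  congr 1
  · simp only [ite_and, mul_ite, mul_zero, Finset.sum_ite_eq, Finset.mem_univ, if_true, map_sum,
      map_mul, Complex.conj_ofReal, Finset.sum_mul_sum, Finset.sum_ite_irrel,
      Finset.sum_const_zero]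
    refine Finset.sum_congr rfl fun i _ => Finset.sum_congr rfl fun k _ => ?_
    ring
  · simp only [ite_and, mul_ite, mul_zero, Finset.sum_ite_eq, Finset.mem_univ, if_true,
      Finset.sum_ite_irrel, Finset.sum_const_zero]
    refine Finset.sum_congr rfl fun i _ => Finset.sum_congr rfl fun k _ => ?_
    ring

/-- The covariance `𝔼 X̄ Y` of `X = ∑ f i Z i` and `Y = ∑ g i Z i`. -/
def covForm (v : ι → ℝ≥0) (f g : ι → ℂ) : ℂ := ∑ i, (v i : ℂ) * (starRingEnd ℂ (f i) * g i)

lemma sum_conj_mul_eq_quadForm {κ : Type*} [Fintype κ] (d : κ → ℂ) (f g : κ → ι → ℂ) (z : ι → ℂ) :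
    ∑ r, d r * (starRingEnd ℂ (∑ i, f r i * z i) * ∑ j, g r j * z j) =
      ∑ i, ∑ j, (∑ r, d r * (starRingEnd ℂ (f r i) * g r j)) * (starRingEnd ℂ (z i) * z j) := by
  simp only [map_sum, map_mul, Finset.sum_mul]
  simp only [Finset.mul_sum]
  rw [Finset.sum_comm]
  refine Finset.sum_congr rfl fun i _ => ?_
  rw [Finset.sum_comm]
  refine Finset.sum_congr rfl fun j _ => Finset.sum_congr rfl fun r _ => ?_
  ring

lemma integrable_norm_sq_sum_conj_mul (hZ : ∀ i, HasLaw (Z i) (complexNormal (v i)) μ)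
    {κ : Type*} [Fintype κ] (d : κ → ℂ) (f g : κ → ι → ℂ) :
    Integrable (fun s => ‖∑ r, d r * (starRingEnd ℂ (∑ i, f r i * Z i s) *
      ∑ j, g r j * Z j s)‖ ^ 2) μ := by
  have h := memLp_quadForm hZ fun i j => ∑ r, d r * (starRingEnd ℂ (f r i) * g r j)
  simp only [sum_conj_mul_eq_quadForm d f g]
  exact (memLp_two_iff_integrable_sq_norm h.1).1 h

/-- Take `A i j = ∑ d_r f̄_{ri} g_{rj}` in `integral_norm_sq_quadForm`. Expanding `|A i j|²` over
`r, t` lets the sums over `i` and `j` separate into two covariances. -/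
theorem integral_norm_sq_sum_conj_mul (hZ : ∀ i, HasLaw (Z i) (complexNormal (v i)) μ)
    (hind : iIndepFun Z μ) {κ : Type*} [Fintype κ] (d : κ → ℂ) (f g : κ → ι → ℂ) :
    ((∫ s, ‖∑ r, d r * (starRingEnd ℂ (∑ i, f r i * Z i s) *
        ∑ j, g r j * Z j s)‖ ^ 2 ∂μ : ℝ) : ℂ) =
      (∑ r, d r * covForm v (f r) (g r)) * starRingEnd ℂ (∑ r, d r * covForm v (f r) (g r)) +
        ∑ r, ∑ t, d r * starRingEnd ℂ (d t) *
          (covForm v (f r) (f t) * starRingEnd ℂ (covForm v (g r) (g t))) := by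
  simp only [sum_conj_mul_eq_quadForm d f g]
  rw [integral_norm_sq_quadForm hZ hind]
  have e : ∑ i, (v i : ℂ) * ∑ r, d r * (starRingEnd ℂ (f r i) * g r i) =
      ∑ r, d r * covForm v (f r) (g r) := by
    simp only [covForm, Finset.mul_sum]
    rw [Finset.sum_comm]
    refine Finset.sum_congr rfl fun r _ => Finset.sum_congr rfl fun i _ => ?_
    ring
  rw [e]
  congr 1
  calc _ = ∑ i, ∑ j, ∑ r, ∑ t, (d r * starRingEnd ℂ (d t)) *
        (((v i : ℂ) * (starRingEnd ℂ (f r i) * f t i)) *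
          starRingEnd ℂ ((v j : ℂ) * (starRingEnd ℂ (g r j) * g t j))) := by
        refine Finset.sum_congr rfl fun i _ => Finset.sum_congr rfl fun j _ => ?_
        rw [map_sum, Finset.sum_mul_sum, Finset.mul_sum]
        refine Finset.sum_congr rfl fun r _ => ?_
        rw [Finset.mul_sum]
        refine Finset.sum_congr rfl fun t _ => ?_
        simp only [map_mul, Complex.conj_conj, Complex.conj_ofReal]
        ring
    _ = ∑ r, ∑ t, ∑ i, ∑ j, (d r * starRingEnd ℂ (d t)) *
        (((v i : ℂ) * (starRingEnd ℂ (f r i) * f t i)) *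
          starRingEnd ℂ ((v j : ℂ) * (starRingEnd ℂ (g r j) * g t j))) := by
        refine (Finset.sum_congr rfl fun i _ => Finset.sum_comm).trans ?_
        rw [Finset.sum_comm]
        refine Finset.sum_congr rfl fun r _ => ?_
        refine (Finset.sum_congr rfl fun i _ => Finset.sum_comm).trans ?_
        exact Finset.sum_comm
    _ = _ := by
        refine Finset.sum_congr rfl fun r _ => Finset.sum_congr rfl fun t _ => ?_
        simp only [covForm, map_sum]
        rw [Finset.sum_mul_sum]
        simp only [Finset.mul_sum]

end QuadForm

/-! ### The Fejér kernel as a squared geometric sum -/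

section Fejer

lemma fejer_zero (L : ℕ) : fejer L 0 = 1 := by simp [fejer]

lemma fejer_neg (L : ℕ) (φ : ℝ) : fejer L (-φ) = fejer L φ := by simp [fejer]

lemma normSq_exp_sub_one (φ : ℝ) :
    Complex.normSq (Complex.exp (φ * Complex.I) - 1) = 2 * (1 - Real.cos φ) := by
  rw [Complex.normSq_apply, Complex.sub_re, Complex.sub_im, Complex.exp_ofReal_mul_I_re,
    Complex.exp_ofReal_mul_I_im, Complex.one_re, Complex.one_im]
  linear_combination Real.sin_sq_add_cos_sq φ

lemma normSq_sum_exp (L : ℕ) (hL : L ≠ 0) (φ : ℝ) :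
    Complex.normSq (∑ l : Fin L, Complex.exp (φ * Complex.I) ^ (l : ℕ)) =
      (L : ℝ) ^ 2 * fejer L φ := by
  rw [Fin.sum_univ_eq_sum_range (fun l => Complex.exp (φ * Complex.I) ^ l)]
  have hn := normSq_exp_sub_one φ
  rw [fejer]
  split_ifs with h
  · have : Complex.exp (φ * Complex.I) = 1 := by
      rw [h] at hn
      exact sub_eq_zero.1 (Complex.normSq_eq_zero.1 (by simpa using hn))
    simp [this, Complex.normSq_natCast, sq]
  · have h1 : 1 - Real.cos φ ≠ 0 := sub_ne_zero.2 (Ne.symm h)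
    have hne : Complex.exp (φ * Complex.I) ≠ 1 := by
      intro h0
      rw [h0] at hn
      simp at hn
      exact h1 hn
    have e : Complex.exp (φ * Complex.I) ^ L = Complex.exp (((L * φ : ℝ) : ℂ) * Complex.I) := by
      rw [← Complex.exp_nat_mul]; push_cast; ring_nf
    rw [geom_sum_eq hne, map_div₀, e, normSq_exp_sub_one, hn]
    field_simp

end Fejer

/-! ### Channel entries as linear forms, and their covariances -/

section Coefficients

variable {B U L W : ℕ}

/-- The coefficient of `H_l` in the channel on subcarrier `w`. -/
noncomputable def phase (L : ℕ) {W : ℕ} (w : Fin W) (l : Fin L) : ℂ :=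
  Complex.exp (-(Complex.I * (2 * Real.pi * ((w : ℕ) : ℂ) * ((l : ℕ) : ℂ)) / (W : ℂ)))

/-- The coefficients of the entry `(b, u)` of the channel on subcarrier `w` as a linear form in the
taps and estimation errors. -/
noncomputable def entryCoeff (L : ℕ) (δ σ : ℝ) (w : Fin W) (b : Fin B) (u : Fin U) :
    (Fin L × Fin B × Fin U) ⊕ (Fin W × Fin B × Fin U) → ℂ :=
  Sum.elim
    (fun i => if i.2.2 = u then phase L w i.1 * CFC.sqrt (corrMatrix B δ) b i.2.1 else 0)
    (fun i => if i = (w, b, u) then (σ : ℂ) else 0)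

/-- The variances of the taps and estimation errors. -/
noncomputable def entryVar (B U L W : ℕ) : (Fin L × Fin B × Fin U) ⊕ (Fin W × Fin B × Fin U) → ℝ≥0 :=
  Sum.elim (fun _ => 1 / ((B : ℝ≥0) * (L : ℝ≥0))) (fun _ => 1)

lemma freqChannel_apply (δ σ : ℝ) (Hu : Fin L → Matrix (Fin B) (Fin U) ℂ)
    (E : Fin W → Matrix (Fin B) (Fin U) ℂ) (w : Fin W) (b : Fin B) (u : Fin U) :
    freqChannel δ σ Hu E w b u = ∑ i, entryCoeff L δ σ w b u i *
      Sum.elim (fun (i : Fin L × Fin B × Fin U) => Hu i.1 i.2.1 i.2.2)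
        (fun (i : Fin W × Fin B × Fin U) => E i.1 i.2.1 i.2.2) i := by
  rw [Fintype.sum_sum_type]
  simp only [entryCoeff, Sum.elim_inl, Sum.elim_inr, ite_mul, zero_mul, Finset.sum_ite_eq',
    Finset.mem_univ, if_true, Fintype.sum_prod_type]
  simp only [freqChannel, Matrix.add_apply, Matrix.sum_apply, Matrix.smul_apply, timeChannel,
    Matrix.mul_apply, smul_eq_mul, phase, Finset.mul_sum, mul_assoc]

lemma sum_conj_sqrt_mul_sqrt {δ : ℝ} (hδ : (corrMatrix B δ).PosSemidef) (b c : Fin B) :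
    ∑ d, starRingEnd ℂ (CFC.sqrt (corrMatrix B δ) b d) * CFC.sqrt (corrMatrix B δ) c d =
      corrMatrix B δ c b := by
  have hs : (CFC.sqrt (corrMatrix B δ))ᴴ = CFC.sqrt (corrMatrix B δ) :=
    (CFC.sqrt_nonneg (corrMatrix B δ)).isSelfAdjoint
  have hm := CFC.sqrt_mul_sqrt_self (corrMatrix B δ) hδ.nonneg
  conv_rhs => rw [← hm, Matrix.mul_apply]
  refine Finset.sum_congr rfl fun d _ => ?_
  conv_rhs => rw [mul_comm, ← hs, Matrix.conjTranspose_apply, hs]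
  rfl

/-- All subcarriers share the taps, so these correlate through the phases and `R`. The estimation
noise correlates only with itself, and distinct users are uncorrelated. -/
lemma covForm_entryCoeff {δ : ℝ} (hδ : (corrMatrix B δ).PosSemidef) (σ : ℝ) (x y : Fin W)
    (b c : Fin B) (u u' : Fin U) :
    covForm (entryVar B U L W) (entryCoeff L δ σ x b u) (entryCoeff L δ σ y c u') =
      if u = u' then
        (∑ l, starRingEnd ℂ (phase L x l) * phase L y l) / (B * L) * corrMatrix B δ c b +
          if x = y ∧ b = c then (σ : ℂ) ^ 2 else 0
      else 0 := by
  rw [covForm, Fintype.sum_sum_type]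
  simp only [entryCoeff, entryVar, Sum.elim_inl, Sum.elim_inr, apply_ite (starRingEnd ℂ), map_zero,
    ite_mul, zero_mul, mul_ite, mul_zero, Finset.sum_ite_eq', Finset.mem_univ, if_true,
    Fintype.sum_prod_type, Prod.mk.injEq]
  by_cases h : u = u'
  · subst h
    rw [if_pos rfl, ← sum_conj_sqrt_mul_sqrt hδ, div_mul_eq_mul_div, Finset.sum_mul_sum,
      Finset.sum_div]
    congr 1
    · refine Finset.sum_congr rfl fun l _ => ?_
      rw [Finset.sum_div]
      refine Finset.sum_congr rfl fun d _ => ?_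
      rw [if_pos rfl, map_mul]
      push_cast
      ring
    · simp [sq, eq_comm]
  · simp [h, Ne.symm h]

lemma sum_conj_phase_mul_phase_self (x : Fin W) :
    ∑ l, starRingEnd ℂ (phase L x l) * phase L x l = L := by
  have h (l : Fin L) : starRingEnd ℂ (phase L x l) * phase L x l = 1 := by
    rw [phase, ← Complex.exp_conj, ← Complex.exp_add]
    simp only [map_neg, map_div₀, map_mul, map_natCast, map_ofNat, Complex.conj_I,
      Complex.conj_ofReal]
    rw [← Complex.exp_zero]
    congr 1
    ring
  simp [h]

lemma normSq_sum_conj_phase_mul_phase (hL : L ≠ 0) (x y : Fin W) :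
    Complex.normSq (∑ l, starRingEnd ℂ (phase L x l) * phase L y l) =
      (L : ℝ) ^ 2 * fejer L (2 * Real.pi / W * (((x : ℕ) : ℝ) - ((y : ℕ) : ℝ))) := by
  rw [← normSq_sum_exp L hL]
  congr 1
  refine Finset.sum_congr rfl fun l _ => ?_
  rw [phase, phase, ← Complex.exp_conj, ← Complex.exp_add, ← Complex.exp_nat_mul]
  congr 1
  simp only [map_neg, map_div₀, map_mul, map_natCast, map_ofNat, Complex.conj_I,
    Complex.conj_ofReal]
  push_cast
  ring

lemma sum_sum_ite_eq (α β : ℂ) :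
    ∑ b : Fin B, ∑ c : Fin B, (if b = c then α else β) = B * α + B * (B - 1) * β := by
  have h (b c : Fin B) : (if b = c then α else β) = (if b = c then α - β else 0) + β := by
    split_ifs <;> ring
  simp only [h, Finset.sum_add_distrib, Finset.sum_ite_eq, Finset.mem_univ, if_true,
    Finset.sum_const, Finset.card_univ, Fintype.card_fin, nsmul_eq_mul]
  ring

/-- Total squared covariance between the columns of the channel on two subcarriers. -/
lemma sum_sq_cov (hB : B ≠ 0) (hL : L ≠ 0) (δ σ : ℝ) (x y : Fin W) :
    ∑ b : Fin B, ∑ c : Fin B,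
      (((∑ l, starRingEnd ℂ (phase L x l) * phase L y l) / (B * L) * corrMatrix B δ c b +
          if x = y ∧ b = c then (σ : ℂ) ^ 2 else 0) *
        starRingEnd ℂ ((∑ l, starRingEnd ℂ (phase L x l) * phase L y l) / (B * L) *
          corrMatrix B δ c b + if x = y ∧ b = c then (σ : ℂ) ^ 2 else 0)) =
      (((1 + epsCor B δ) / B * fejer L (2 * Real.pi / W * (((x : ℕ) : ℝ) - ((y : ℕ) : ℝ))) +
        if x = y then epsCSI B σ / 2 else 0 : ℝ) : ℂ) := by
  have hBc : (B : ℂ) ≠ 0 := by exact_mod_cast hB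
  have hLc : (L : ℂ) ≠ 0 := by exact_mod_cast hL
  have hT := normSq_sum_conj_phase_mul_phase hL x y
  replace hT := congrArg (fun r : ℝ => (r : ℂ)) hT
  simp only [← Complex.mul_conj] at hT
  -- For `x = y` the noise adds `σ²` on the diagonal: the cross terms `2σ²` and the squares `Bσ⁴`
  -- together make `ε_CSI / 2`.
  by_cases hxy : x = y
  · subst hxy
    rw [sum_conj_phase_mul_phase_self]
    have e (b c : Fin B) : (((L : ℂ) / (B * L) * corrMatrix B δ c b +
        if x = x ∧ b = c then (σ : ℂ) ^ 2 else 0) * starRingEnd ℂ ((L : ℂ) / (B * L) *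
          corrMatrix B δ c b + if x = x ∧ b = c then (σ : ℂ) ^ 2 else 0)) =
        if b = c then (1 / (B : ℂ) + (σ : ℂ) ^ 2) ^ 2 else ((δ : ℂ) / B) ^ 2 := by
      by_cases h : b = c
      · subst h
        simp [corrMatrix]
        field_simp
      · simp [corrMatrix, h, Ne.symm h]
        field_simp
    refine (Finset.sum_congr rfl fun b _ => Finset.sum_congr rfl fun c _ => e b c).trans ?_
    rw [sum_sum_ite_eq]
    simp [fejer_zero, epsCor, epsCSI]
    field_simp
    ring
  · set T := ∑ l, starRingEnd ℂ (phase L x l) * phase L y l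
    have e (b c : Fin B) : ((T / (B * L) * corrMatrix B δ c b +
        if x = y ∧ b = c then (σ : ℂ) ^ 2 else 0) * starRingEnd ℂ (T / (B * L) *
          corrMatrix B δ c b + if x = y ∧ b = c then (σ : ℂ) ^ 2 else 0)) =
        if b = c then T * starRingEnd ℂ T / (B * L) ^ 2
          else T * starRingEnd ℂ T / (B * L) ^ 2 * δ ^ 2 := by
      by_cases h : b = c
      · subst h
        simp [corrMatrix, hxy]
        field_simp
      · simp [corrMatrix, h, Ne.symm h]
        field_simp
    refine (Finset.sum_congr rfl fun b _ => Finset.sum_congr rfl fun c _ => e b c).trans ?_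
    rw [sum_sum_ite_eq, hT]
    simp [hxy, epsCor]
    field_simp

/-- Mean squared modulus of a linear combination of Gram entries with weights of sum zero. -/
theorem integral_norm_sq_sum_gram {S : Type*} [MeasurableSpace S] {μ : Measure S}
    (hB : B ≠ 0) (hL : L ≠ 0) {δ : ℝ} (hδ : (corrMatrix B δ).PosSemidef) (σ : ℝ)
    {Hu : Fin L → S → Matrix (Fin B) (Fin U) ℂ} {E : Fin W → S → Matrix (Fin B) (Fin U) ℂ}
    (hHu : ∀ l b u, HasLaw (fun s => Hu l s b u)
      (complexNormal (1 / ((B : ℝ≥0) * (L : ℝ≥0)))) μ)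
    (hE : ∀ w b u, HasLaw (fun s => E w s b u) (complexNormal 1) μ)
    (hind : iIndepFun
      (Sum.elim
        (fun (i : Fin L × Fin B × Fin U) (s : S) => Hu i.1 s i.2.1 i.2.2)
        (fun (i : Fin W × Fin B × Fin U) (s : S) => E i.1 s i.2.1 i.2.2)) μ)
    {κ : Type*} [Fintype κ] (x : κ → Fin W) (a : κ → ℝ) (ha : ∑ r, a r = 0) (m n : Fin U) :
    Integrable (fun s => ‖∑ r, (a r : ℂ) *
      gram δ σ (fun l => Hu l s) (fun v => E v s) (x r) m n‖ ^ 2) μ ∧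
    ∫ s, ‖∑ r, (a r : ℂ) * gram δ σ (fun l => Hu l s) (fun v => E v s) (x r) m n‖ ^ 2 ∂μ =
      ∑ r, ∑ t, a r * a t * ((1 + epsCor B δ) / B *
        fejer L (2 * Real.pi / W * (((x r : ℕ) : ℝ) - ((x t : ℕ) : ℝ))) +
          if x r = x t then epsCSI B σ / 2 else 0) := by
  set Z : (Fin L × Fin B × Fin U) ⊕ (Fin W × Fin B × Fin U) → S → ℂ := Sum.elim
        (fun (i : Fin L × Fin B × Fin U) (s : S) => Hu i.1 s i.2.1 i.2.2)
        (fun (i : Fin W × Fin B × Fin U) (s : S) => E i.1 s i.2.1 i.2.2) with hZdef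
  have hZ (i) : HasLaw (Z i) (complexNormal (entryVar B U L W i)) μ := by
    rcases i with i | i
    · exact hHu _ _ _
    · exact hE _ _ _
  let f (u : Fin U) (r : κ × Fin B) := entryCoeff L δ σ (x r.1) r.2 u
  have hf (s : S) (r : κ) (b : Fin B) (u : Fin U) :
      freqChannel δ σ (fun l => Hu l s) (fun v => E v s) (x r) b u = ∑ i, f u (r, b) i * Z i s := by
    rw [freqChannel_apply]
    refine Finset.sum_congr rfl fun i _ => ?_
    rcases i with i | i <;> rfl
  have e (s : S) : ∑ r, (a r : ℂ) * gram δ σ (fun l => Hu l s) (fun v => E v s) (x r) m n =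
      ∑ r : κ × Fin B, (a r.1 : ℂ) *
        (starRingEnd ℂ (∑ i, f m r i * Z i s) * ∑ i, f n r i * Z i s) := by
    rw [Fintype.sum_prod_type]
    simp only [gram, Matrix.mul_apply, Matrix.conjTranspose_apply,
      Finset.mul_sum (s := Finset.univ (α := Fin B)), ← hf]
    rfl
  simp only [e]
  refine ⟨integrable_norm_sq_sum_conj_mul hZ _ _ _, Complex.ofReal_injective ?_⟩
  rw [integral_norm_sq_sum_conj_mul hZ hind]
  -- The mean does not depend on the subcarrier, so the zero-sum weights cancel it.
  have hzero : ∑ r : κ × Fin B, (a r.1 : ℂ) *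
      covForm (entryVar B U L W) (f m r) (f n r) = 0 := by
    simp only [f, covForm_entryCoeff hδ, sum_conj_phase_mul_phase_self, Fintype.sum_prod_type]
    simp only [corrMatrix, Matrix.of_apply, and_self, if_true, ← Finset.mul_sum, ← Finset.sum_mul,
      ← Complex.ofReal_sum, ha, Complex.ofReal_zero, zero_mul]
  rw [hzero, zero_mul, zero_add, Complex.ofReal_sum, Fintype.sum_prod_type]
  refine Finset.sum_congr rfl fun r _ => ?_
  simp only [Fintype.sum_prod_type]
  rw [Finset.sum_comm, Complex.ofReal_sum]
  refine Finset.sum_congr rfl fun t _ => ?_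
  rw [Complex.ofReal_mul, ← sum_sq_cov hB hL]
  simp only [Finset.mul_sum, f, covForm_entryCoeff hδ, if_true, Complex.conj_ofReal,
    Complex.ofReal_mul]

end Coefficients

end GramInterp

/-! ### The three-point error -/

theorem theorem2
    {S : Type*} [MeasurableSpace S] (μ : Measure S) [IsProbabilityMeasure μ]
    (B U L W : ℕ) (hB : 1 ≤ B) (hL : 1 ≤ L) (hLW : L ≤ W)
    (δ σ : ℝ) (hδ : (GramInterp.corrMatrix B δ).PosSemidef) (hσ : 0 ≤ σ)
    -- uncorrelated time-domain taps and channel-estimation errors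
    (Hu : Fin L → S → Matrix (Fin B) (Fin U) ℂ)
    (E : Fin W → S → Matrix (Fin B) (Fin U) ℂ)
    (hHu : ∀ l b u, HasLaw (fun s => Hu l s b u)
      (GramInterp.complexNormal (1 / ((B : ℝ≥0) * (L : ℝ≥0)))) μ)
    (hE : ∀ w b u, HasLaw (fun s => E w s b u) (GramInterp.complexNormal 1) μ)
    -- all these entries are jointly independent
    (hind : iIndepFun
      (Sum.elim
        (fun (i : Fin L × Fin B × Fin U) (s : S) => Hu i.1 s i.2.1 i.2.2)
        (fun (i : Fin W × Fin B × Fin U) (s : S) => E i.1 s i.2.1 i.2.2)) μ)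
    -- active subcarriers, base points in increasing order, target subcarrier
    (active : Finset (Fin W)) (K : ℕ) (p : Fin K → Fin W) (hp : StrictMono p)
    (hpa : ∀ i, p i ∈ active)
    (w : Fin W) (hw : w ∈ active) (hwp : ∀ i, w ≠ p i)
    (k : ℕ) (hk : k + 1 < K)
    (hkw : p ⟨k, Nat.lt_of_succ_lt hk⟩ ≤ w) (hwk : w ≤ p ⟨k + 1, hk⟩)
    (lam θ : ℝ)
    (hlam : lam = GramInterp.weight (p ⟨k, Nat.lt_of_succ_lt hk⟩) (p ⟨k + 1, hk⟩) w)
    (hθ : θ = 2 * Real.pi / W *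
      (((p ⟨k + 1, hk⟩ : ℕ) : ℝ) - ((p ⟨k, Nat.lt_of_succ_lt hk⟩ : ℕ) : ℝ)))
    (m n : Fin U) :
    Integrable (fun s => GramInterp.sqError δ σ (fun l => Hu l s) (fun v => E v s)
      (p ⟨k, Nat.lt_of_succ_lt hk⟩) (p ⟨k + 1, hk⟩) w m n) μ ∧
    ∫ s, GramInterp.sqError δ σ (fun l => Hu l s) (fun v => E v s)
      (p ⟨k, Nat.lt_of_succ_lt hk⟩) (p ⟨k + 1, hk⟩) w m n ∂μ
      = GramInterp.epsCSI B σ * (1 - lam * (1 - lam))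
        + 2 / (B : ℝ) * (1 + GramInterp.epsCor B δ) *
          (1 - lam * (1 - lam) + lam * (1 - lam) * GramInterp.fejer L θ
            - (1 - lam) * GramInterp.fejer L (lam * θ)
            - lam * GramInterp.fejer L ((1 - lam) * θ)) := by
  have hpq := Fin.lt_def.1 (hp (show (⟨k, Nat.lt_of_succ_lt hk⟩ : Fin K) < ⟨k + 1, hk⟩ by
    simp [Fin.lt_def]))
  have hwp0 := hwp ⟨k, Nat.lt_of_succ_lt hk⟩
  have hwp1 := hwp ⟨k + 1, hk⟩
  generalize p ⟨k, Nat.lt_of_succ_lt hk⟩ = x at *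
  generalize p ⟨k + 1, hk⟩ = y at *
  have hxy : x ≠ y := fun h => by simp [h] at hpq
  have h0 : ((y : ℕ) : ℝ) - ((x : ℕ) : ℝ) ≠ 0 := sub_ne_zero.2 (by exact_mod_cast hpq.ne')
  -- `λθ` is the phase distance from `w` to the right base point, whose weight is `1 - λ`; this
  -- explains the crossed factors in the formula.
  have h1 : lam * θ = 2 * Real.pi / W * (((y : ℕ) : ℝ) - ((w : ℕ) : ℝ)) := by
    rw [hlam, hθ, GramInterp.weight]; field_simp
  have h2 : (1 - lam) * θ = 2 * Real.pi / W * (((w : ℕ) : ℝ) - ((x : ℕ) : ℝ)) := by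
    rw [sub_mul, h1, hθ]; ring
  have e (s : S) : GramInterp.sqError δ σ (fun l => Hu l s) (fun v => E v s) x y w m n =
      ‖∑ r : Fin 3, ((![lam, 1 - lam, -1] r : ℝ) : ℂ) * GramInterp.gram δ σ (fun l => Hu l s)
        (fun v => E v s) (![x, y, w] r) m n‖ ^ 2 := by
    rw [GramInterp.sqError, GramInterp.linInterp, ← hlam]
    simp [Fin.sum_univ_three, sub_eq_add_neg]
  obtain ⟨hi, hv⟩ := GramInterp.integral_norm_sq_sum_gram (by omega) (by omega) hδ σ hHu hE hind
    ![x, y, w] ![lam, 1 - lam, -1] (by simp [Fin.sum_univ_three]) m n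
  simp only [e]
  refine ⟨hi, hv.trans ?_⟩
  have s0 (φ : ℝ) (c d : ℝ) :
      GramInterp.fejer L (φ * (c - d)) = GramInterp.fejer L (φ * (d - c)) := by
    rw [← GramInterp.fejer_neg, ← mul_neg, neg_sub]
  -- The three subcarriers are distinct, so `ε_CSI` enters only through the diagonal terms; evenness
  -- of the kernel merges each off-diagonal pair.
  rw [h1, h2, hθ]
  simp only [Fin.sum_univ_three, Matrix.cons_val_zero, Matrix.cons_val_one, Matrix.cons_val,
    sub_self, mul_zero, GramInterp.fejer_zero, hxy, hxy.symm, hwp0, hwp0.symm, hwp1, hwp1.symm,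
    if_true, if_false, s0 _ ((x : ℕ) : ℝ) ((y : ℕ) : ℝ), s0 _ ((x : ℕ) : ℝ) ((w : ℕ) : ℝ),
    s0 _ ((w : ℕ) : ℝ) ((y : ℕ) : ℝ)]
  ring
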